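/- For $n\ge 1$ let $$g=\sum_{i,j=1}^n \frac{\partial^2 e^{|z|^2}}{\partial z_i\,\partial\bar z_j}\,dz_i\otimes d\bar z_j ,\qquad |z|^2=|z_1|^2+\dots+|z_n|^2,$$ be the metric on $\mathbb C^n$ with potential $f(|z|^2)$, $f(x)=e^x$ (the associated Riemannian metric is $\operatorname{Re} g$). Then $g$ is a Kähler metric and is complete (that is, $\mathbb C^n$ with the Riemannian distance of $g$ is a complete metric space); its sectional curvature is strictly negative at every point and on every real $2$-plane, and there is a constant $d\in\mathbb R$ with $K>d$ everywhere. Moreover some sectional curvatures tend to zero exponentially fast at infinity: there is $C>0$ such that at every $z\in\mathbb C^n$ there is a real $2$-plane on which $-Ce^{-|z|^2}\le K<0$. Consequently, the upper curvature bound is necessary in the theorem that a product $M_1\times M_2$ of complex manifolds with $\dim M_i\ge1$ admits no complete Kähler metric with sectional curvature $K<c<0$ and Ricci curvature $\mathrm{Ric}>d$, where $c,d$ are constants: it cannot be weakened to $K<0$. Indeed, for all $p,q\ge 1$ and under any $\mathbb C$-linear isomorphism $\mathbb C^p\times\mathbb C^q\cong\mathbb C^{p+q}$, the metric above (with $n=p+q$)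 is a complete Kähler metric on the product complex manifold $\mathbb C^p\times\mathbb C^q$ with $K<0$ everywhere and $\mathrm{Ric}>d'$ (i.e. $\mathrm{Ric}(v,v)>d'\,g(v,v)$ for all $v\ne0$) for some constant $d'$. -/

import Mathlib

set_option maxSynthPendingDepth 3

noncomputable section

namespace KahlerExample

open scoped ContDiff Topology ENNReal ComplexConjugate

/-! ## Riemannian geometry in a global chart

A tensor field `g : E → E →L[ℝ] E →L[ℝ] ℝ` on a finite-dimensional vector space `E` is regarded as a
Riemannian metric on the manifold `E`, whose tangent spaces are all identified with `E`. -/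

section Riemannian

variable {E : Type*} [NormedAddCommGroup E] [NormedSpace ℝ E]

/-- `g` is a smooth Riemannian metric on `E`. -/
structure IsRiemannianMetric (g : E → E →L[ℝ] E →L[ℝ] ℝ) : Prop where
  smooth : ContDiff ℝ ∞ g
  symm : ∀ x u v, g x u v = g x v u
  pos : ∀ x u, u ≠ 0 → 0 < g x u u

/-- The `g`-length of the curve `γ` restricted to `[0, 1]`. -/
def pathLength (g : E → E →L[ℝ] E →L[ℝ] ℝ) (γ : ℝ → E) : ℝ≥0∞ :=
  ∫⁻ t in Set.Icc (0 : ℝ) 1, ENNReal.ofReal (√(g (γ t) (deriv γ t) (deriv γ t)))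

/-- The Riemannian distance: the infimum of the lengths of the `C¹` curves from `x` to `y`. -/
def riemDist (g : E → E →L[ℝ] E →L[ℝ] ℝ) (x y : E) : ℝ≥0∞ :=
  ⨅ (γ : ℝ → E) (_ : ContDiff ℝ 1 γ) (_ : γ 0 = x) (_ : γ 1 = y), pathLength g γ

/-- Completeness of `E` with the Riemannian distance of `g`: every Cauchy sequence converges. -/
def IsCompleteMetric (g : E → E →L[ℝ] E →L[ℝ] ℝ) : Prop :=
  ∀ s : ℕ → E,
    (∀ ε : ℝ≥0∞, 0 < ε → ∃ N, ∀ m, N ≤ m → ∀ k, N ≤ k → riemDist g (s m) (s k) < ε) →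
    ∃ x, Filter.Tendsto (fun m => riemDist g (s m) x) Filter.atTop (𝓝 0)

/-- The trilinear form `(u, v, w) ↦ (D_u g)(v, w) + (D_v g)(u, w) - (D_w g)(u, v)`. -/
def koszul (g : E → E →L[ℝ] E →L[ℝ] ℝ) (x : E) : E →L[ℝ] E →L[ℝ] E →L[ℝ] ℝ :=
  (fderiv ℝ g x + (fderiv ℝ g x).flip : E →L[ℝ] E →L[ℝ] E →L[ℝ] ℝ) -
    ((ContinuousLinearMap.flipₗᵢ ℝ E E ℝ).toContinuousLinearEquiv :
      (E →L[ℝ] E →L[ℝ] ℝ) →L[ℝ] E →L[ℝ] E →L[ℝ] ℝ).comp (fderiv ℝ g x).flip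

theorem koszul_apply (g : E → E →L[ℝ] E →L[ℝ] ℝ) (x u v w : E) :
    koszul g x u v w = fderiv ℝ g x u v w + fderiv ℝ g x v u w - fderiv ℝ g x w u v := by
  simp [koszul]

/-- The Christoffel map of the Levi-Civita connection: `christoffel g x u v` is the vector `Γ(u, v)`
with `2 g(Γ(u, v), w) = koszul g x u v w` for all `w`, that is, `∇_u v` for constant fields. -/
def christoffel (g : E → E →L[ℝ] E →L[ℝ] ℝ) (x : E) : E →L[ℝ] E →L[ℝ] E :=
  (2⁻¹ : ℝ) • (ContinuousLinearMap.compL ℝ E (E →L[ℝ] ℝ) E (g x).inverse).comp (koszul g x)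

theorem christoffel_apply (g : E → E →L[ℝ] E →L[ℝ] ℝ) (x u v : E) :
    christoffel g x u v = (2⁻¹ : ℝ) • (g x).inverse (koszul g x u v) := by
  simp [christoffel]

theorem christoffel_spec [FiniteDimensional ℝ E] {g : E → E →L[ℝ] E →L[ℝ] ℝ}
    (hg : IsRiemannianMetric g) (x u v w : E) :
    2 * g x (christoffel g x u v) w = koszul g x u v w := by
  have hinj : Function.Injective (g x : E →ₗ[ℝ] E →L[ℝ] ℝ) := by
    refine (injective_iff_map_eq_zero _).2 fun a ha => ?_
    by_contra h
    have h1 := hg.pos x a h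
    have h2 : g x a = 0 := ha
    simp [h2] at h1
  have hdim : Module.finrank ℝ E = Module.finrank ℝ (E →L[ℝ] ℝ) := by
    rw [← (LinearMap.toContinuousLinearMap : (E →ₗ[ℝ] ℝ) ≃ₗ[ℝ] (E →L[ℝ] ℝ)).finrank_eq]
    exact (Subspace.dual_finrank_eq (K := ℝ) (V := E)).symm
  let e : E ≃L[ℝ] (E →L[ℝ] ℝ) :=
    (LinearEquiv.ofInjectiveOfFinrankEq _ hinj hdim).toContinuousLinearEquiv
  have he : g x = (e : E →L[ℝ] E →L[ℝ] ℝ) := by ext; rfl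
  rw [christoffel_apply, he, ContinuousLinearMap.inverse_equiv]
  simp

/-- The curvature tensor `R(u, v) w = ∇_u ∇_v w - ∇_v ∇_u w - ∇_[u,v] w`, evaluated on constant
fields. -/
def curvature (g : E → E →L[ℝ] E →L[ℝ] ℝ) (x u v w : E) : E :=
  fderiv ℝ (christoffel g) x u v w - fderiv ℝ (christoffel g) x v u w
    + christoffel g x u (christoffel g x v w) - christoffel g x v (christoffel g x u w)

/-- The sectional curvature of the plane spanned by the linearly independent vectors `u`, `v`. -/
def sectionalCurvature (g : E → E →L[ℝ] E →L[ℝ] ℝ) (x u v : E) : ℝ :=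
  g x (curvature g x u v v) u / (g x u u * g x v v - g x u v ^ 2)

/-- The endomorphism `u ↦ R(u, v) w`. -/
def curvatureEnd (g : E → E →L[ℝ] E →L[ℝ] ℝ) (x v w : E) : E →ₗ[ℝ] E where
  toFun u := curvature g x u v w
  map_add' a b := by
    simp only [curvature, map_add, add_apply]
    abel
  map_smul' c a := by
    simp only [curvature, map_smul, smul_apply, RingHom.id_apply, smul_sub,
      smul_add]

/-- The Ricci tensor `Ric(v, w) = tr (u ↦ R(u, v) w)`. -/
def ricci (g : E → E →L[ℝ] E →L[ℝ] ℝ) (x v w : E) : ℝ :=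
  LinearMap.trace ℝ E (curvatureEnd g x v w)

/-- The sectional curvature is strictly negative at every point and on every plane. -/
def NegativeSectional (g : E → E →L[ℝ] E →L[ℝ] ℝ) : Prop :=
  ∀ x u v : E, LinearIndependent ℝ ![u, v] → sectionalCurvature g x u v < 0

/-- The sectional curvature is bounded below by a constant. -/
def SectionalBoundedBelow (g : E → E →L[ℝ] E →L[ℝ] ℝ) : Prop :=
  ∃ d : ℝ, ∀ x u v : E, LinearIndependent ℝ ![u, v] → d < sectionalCurvature g x u v

/-- The Ricci curvature is bounded below: `Ric > d` for some constant `d`. -/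
def RicciBoundedBelow (g : E → E →L[ℝ] E →L[ℝ] ℝ) : Prop :=
  ∃ d : ℝ, ∀ x v : E, v ≠ 0 → d * g x v v < ricci g x v v

end Riemannian

/-! ## Kähler metrics in a global holomorphic chart -/

section Kahler

variable {E : Type*} [NormedAddCommGroup E] [NormedSpace ℂ E]

/-- `g` is (the real part of) a Kähler metric on the complex manifold `E`: a Riemannian metric that
is invariant under multiplication by `i` and whose fundamental form `ω(u, v) = g(i u, v)` is
closed; `closed` says `dω(u, v, w) = 0` on constant fields. -/
structure IsKahlerMetric (g : E → E →L[ℝ] E →L[ℝ] ℝ) : Prop where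
  riemannian : IsRiemannianMetric g
  hermitian : ∀ x u v, g x (Complex.I • u) (Complex.I • v) = g x u v
  closed : ∀ x u v w,
    fderiv ℝ g x u (Complex.I • v) w + fderiv ℝ g x v (Complex.I • w) u
      + fderiv ℝ g x w (Complex.I • u) v = 0

/-- The pullback of `g` under a complex linear isomorphism `L`. -/
def pullback {F : Type*} [NormedAddCommGroup F] [NormedSpace ℂ F] (L : F ≃L[ℂ] E)
    (g : E → E →L[ℝ] E →L[ℝ] ℝ) : F → F →L[ℝ] F →L[ℝ] ℝ := fun x =>
  (g (L x)).bilinearComp ((L : F →L[ℂ] E).restrictScalars ℝ) ((L : F →L[ℂ] E).restrictScalars ℝ)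

theorem pullback_apply {F : Type*} [NormedAddCommGroup F] [NormedSpace ℂ F] (L : F ≃L[ℂ] E)
    (g : E → E →L[ℝ] E →L[ℝ] ℝ) (x u v : F) :
    pullback L g x u v = g (L x) (L u) (L v) := by
  simp [pullback]

end Kahler

/-! ## The metric on `ℂⁿ` with potential `f(|z|²)` -/

/-- `ℂⁿ`. -/
abbrev Cn (n : ℕ) : Type := EuclideanSpace ℂ (Fin n)

/-- `ℂᵖ × ℂ^q` and `ℂ^(p + q)` are isomorphic. -/
theorem nonempty_prodEquiv (p q : ℕ) : Nonempty ((Cn p × Cn q) ≃L[ℂ] Cn (p + q)) :=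
  ⟨ContinuousLinearEquiv.ofFinrankEq (by simp [Module.finrank_prod])⟩

/-- The operator `∂/∂z_i = (∂/∂x_i - i ∂/∂y_i) / 2`. -/
def dz {n : ℕ} (i : Fin n) (φ : Cn n → ℂ) : Cn n → ℂ := fun z =>
  (fderiv ℝ φ z (EuclideanSpace.single i 1)
    - Complex.I * fderiv ℝ φ z (EuclideanSpace.single i Complex.I)) / 2

/-- The operator `∂/∂z̄_i = (∂/∂x_i + i ∂/∂y_i) / 2`. -/
def dzbar {n : ℕ} (i : Fin n) (φ : Cn n → ℂ) : Cn n → ℂ := fun z =>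
  (fderiv ℝ φ z (EuclideanSpace.single i 1)
    + Complex.I * fderiv ℝ φ z (EuclideanSpace.single i Complex.I)) / 2

/-- The function `z ↦ f(|z_1|² + ... + |z_n|²)`. -/
def radialPotential (n : ℕ) (f : ℝ → ℝ) : Cn n → ℂ := fun z => (f (∑ k, ‖z k‖ ^ 2) : ℂ)

/-- The coefficient `∂² f(|z|²) / ∂z_i ∂z̄_j`. -/
def coeff (n : ℕ) (f : ℝ → ℝ) (i j : Fin n) : Cn n → ℂ := dz i (dzbar j (radialPotential n f))

/-- The real part of the Hermitian form
`∑ i j, ∂² f(|z|²) / ∂z_i ∂z̄_j dz_i ⊗ dz̄_j`. -/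
def potentialMetric (n : ℕ) (f : ℝ → ℝ) : Cn n → Cn n →L[ℝ] Cn n →L[ℝ] ℝ := fun z =>
  ∑ i, ∑ j, (ContinuousLinearMap.compL ℝ (Cn n) ℂ ℝ Complex.reCLM).comp
    ((ContinuousLinearMap.mul ℝ ℂ).bilinearComp
      (coeff n f i j z • (EuclideanSpace.proj (𝕜 := ℂ) i : Cn n →L[ℂ] ℂ).restrictScalars ℝ)
      ((Complex.conjCLE : ℂ →L[ℝ] ℂ).comp
        ((EuclideanSpace.proj (𝕜 := ℂ) j : Cn n →L[ℂ] ℂ).restrictScalars ℝ)))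

theorem potentialMetric_apply (n : ℕ) (f : ℝ → ℝ) (z u v : Cn n) :
    potentialMetric n f z u v = (∑ i, ∑ j, coeff n f i j z * (u i * conj (v j))).re := by
  simp [potentialMetric, mul_assoc]

end KahlerExample

end

noncomputable section

namespace KahlerExample

open scoped ContDiff Topology ENNReal ComplexConjugate

/-! ### Derivatives of inner products along real lines. -/

section LineDerivatives

variable {V : Type*} [NormedAddCommGroup V] [InnerProductSpace ℂ V]

/-! Write `⟨z,u⟩` for `inner ℂ z u`, linear in `u`. The metric is `e^{|z|²}` times the identity plus
the rank-one form `⟨z,u⟩⟨v,z⟩`, so its inverse is explicit, and so are the Christoffel map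
(`christoffel_potentialMetric_exp`) and the curvature. As for any Kähler metric, `R` is the
antisymmetrised antiholomorphic derivative of the Christoffel map (`curvature_potentialMetric_exp`).

Put `S = |u|²|v|² - (Re⟨u,v⟩)²`, `I = Im⟨u,v⟩` and `J = Im(conj⟨z,u⟩ ⟨z,v⟩)`. Then `g(R(u,v)v,u) =
-e^{|z|²}(S + 3I² + 2J²/(1+|z|²))`, while the squared area is `e^{2|z|²}(S + T + J²)` with a cross
term `T ≥ 0`. Real linear independence gives `S > 0`, hence `K < 0`. Complex Cauchy–Schwarz gives
`I² ≤ S`, so `K ≥ -4e^{-|z|²}` on every plane. This one estimate yields the lower bound, the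
exponential decay and, after taking a trace, the Ricci bound.

Completeness holds because `g` dominates the Euclidean metric. The statement on products follows
because all these notions are natural under linear isomorphisms. -/

theorem fderiv_apply_of_hasDerivAt_line {E F : Type*} [NormedAddCommGroup E] [NormedSpace ℝ E]
    [NormedAddCommGroup F] [NormedSpace ℝ F] {f : E → F} {x v : E} {d : F}
    (hf : DifferentiableAt ℝ f x) (hd : HasDerivAt (fun t : ℝ => f (x + t • v)) d 0) :
    fderiv ℝ f x v = d :=
  (hf.hasFDerivAt.hasLineDerivAt v).unique hd

theorem hasDerivAt_inner_line_left (z w v : V) :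
    HasDerivAt (fun t : ℝ => inner ℂ (z + t • w) v) (inner ℂ w v) 0 := by
  have h : (fun t : ℝ => inner ℂ (z + t • w) v)
      = fun t : ℝ => inner ℂ z v + (t : ℂ) * inner ℂ w v := by
    ext t
    rw [inner_add_left, ← Complex.coe_smul, inner_smul_left, Complex.conj_ofReal]
  rw [h]
  simpa using ((Complex.ofRealCLM.hasDerivAt (x := 0)).mul_const (inner ℂ w v)).const_add
    (inner ℂ z v)

theorem hasDerivAt_inner_line_right (z w v : V) :
    HasDerivAt (fun t : ℝ => inner ℂ v (z + t • w)) (inner ℂ v w) 0 := by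
  have h : (fun t : ℝ => inner ℂ v (z + t • w))
      = fun t : ℝ => inner ℂ v z + (t : ℂ) * inner ℂ v w := by
    ext t
    rw [inner_add_right, ← Complex.coe_smul, inner_smul_right]
  rw [h]
  simpa using ((Complex.ofRealCLM.hasDerivAt (x := 0)).mul_const (inner ℂ v w)).const_add
    (inner ℂ v z)

theorem hasDerivAt_inner_self_line (z w : V) :
    HasDerivAt (fun t : ℝ => inner ℂ (z + t • w) (z + t • w)) (inner ℂ w z + inner ℂ z w) 0 := by
  have h : (fun t : ℝ => inner ℂ (z + t • w) (z + t • w))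
      = fun t : ℝ => inner ℂ (z + t • w) z + (t : ℂ) * inner ℂ (z + t • w) w := by
    ext t
    rw [inner_add_right (z + t • w), ← Complex.coe_smul, inner_smul_right]
  rw [h]
  refine ((hasDerivAt_inner_line_left z w z).add
    ((Complex.ofRealCLM.hasDerivAt (x := 0)).mul (hasDerivAt_inner_line_left z w w))).congr_deriv ?_
  simp

theorem hasDerivAt_cexp_inner_self_line (z w : V) :
    HasDerivAt (fun t : ℝ => Complex.exp (inner ℂ (z + t • w) (z + t • w)))
      (Complex.exp (inner ℂ z z) * (inner ℂ w z + inner ℂ z w)) 0 := by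
  simpa using (hasDerivAt_inner_self_line z w).cexp

theorem contDiff_cexp_inner_self : ContDiff ℝ ∞ fun z : V => Complex.exp (inner ℂ z z) := by
  have : ContDiff ℝ ∞ fun z : V => inner ℂ z z := contDiff_id.inner ℂ contDiff_id
  exact this.cexp

theorem inner_self_eq_ofReal_norm_sq (z : V) : inner ℂ z z = ((‖z‖ ^ 2 : ℝ) : ℂ) := by
  rw [inner_self_eq_norm_sq_to_K]
  simp

theorem cexp_inner_self (z : V) : Complex.exp (inner ℂ z z) = (Real.exp (‖z‖ ^ 2) : ℂ) := by
  rw [inner_self_eq_ofReal_norm_sq, Complex.ofReal_exp]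

theorem one_add_inner_self (z : V) : (1 + inner ℂ z z : ℂ) = ((1 + ‖z‖ ^ 2 : ℝ) : ℂ) := by
  rw [inner_self_eq_ofReal_norm_sq, Complex.ofReal_add, Complex.ofReal_one]

theorem one_add_inner_self_ne_zero (z : V) : (1 + inner ℂ z z : ℂ) ≠ 0 := by
  rw [one_add_inner_self, Ne, Complex.ofReal_eq_zero]
  positivity

end LineDerivatives

/-! ### The metric in invariant form, the Kähler property and the Christoffel map. -/

section Potential

variable {n : ℕ}

theorem radialPotential_exp (n : ℕ) :
    radialPotential n Real.exp = fun z => Complex.exp (inner ℂ z z) := by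
  ext z
  rw [cexp_inner_self, EuclideanSpace.norm_sq_eq, radialPotential]

theorem contDiff_coord (j : Fin n) : ContDiff ℝ ∞ fun z : Cn n => z j :=
  ((EuclideanSpace.proj (𝕜 := ℂ) j : Cn n →L[ℂ] ℂ).restrictScalars ℝ).contDiff

theorem dzbar_radialPotential_exp (j : Fin n) :
    dzbar j (radialPotential n Real.exp) = fun z => z j * Complex.exp (inner ℂ z z) := by
  ext z
  have hd : DifferentiableAt ℝ (fun z : Cn n => Complex.exp (inner ℂ z z)) z :=
    contDiff_cexp_inner_self.differentiable (by simp) z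
  rw [radialPotential_exp, dzbar,
    fderiv_apply_of_hasDerivAt_line hd (hasDerivAt_cexp_inner_self_line z _),
    fderiv_apply_of_hasDerivAt_line hd (hasDerivAt_cexp_inner_self_line z _)]
  simp only [EuclideanSpace.inner_single_left, EuclideanSpace.inner_single_right, map_one,
    Complex.conj_I]
  linear_combination (conj (z j) - z j) * Complex.exp (inner ℂ z z) / 2 * Complex.I_mul_I

theorem hasDerivAt_coord_line (z w : Cn n) (j : Fin n) :
    HasDerivAt (fun t : ℝ => (z + t • w) j) (w j) 0 := by
  simpa only [EuclideanSpace.inner_single_left, map_one, one_mul] using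
    hasDerivAt_inner_line_right z w (EuclideanSpace.single j 1)

theorem coeff_exp (i j : Fin n) :
    coeff n Real.exp i j = fun z =>
      Complex.exp (inner ℂ z z) * ((if i = j then 1 else 0) + conj (z i) * z j) := by
  ext z
  have hd : DifferentiableAt ℝ (fun z : Cn n => z j * Complex.exp (inner ℂ z z)) z :=
    ((contDiff_coord j).mul contDiff_cexp_inner_self).differentiable (by simp) z
  rw [coeff, dzbar_radialPotential_exp, dz,
    fderiv_apply_of_hasDerivAt_line hd
      ((hasDerivAt_coord_line z _ j).mul (hasDerivAt_cexp_inner_self_line z _)),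
    fderiv_apply_of_hasDerivAt_line hd
      ((hasDerivAt_coord_line z _ j).mul (hasDerivAt_cexp_inner_self_line z _))]
  simp only [EuclideanSpace.inner_single_left, EuclideanSpace.inner_single_right, map_one,
    Complex.conj_I, zero_smul, add_zero, PiLp.single_apply]
  by_cases h : i = j
  · subst h
    simp only [if_true]
    linear_combination ((conj (z i) - z i) * z i * Complex.exp (inner ℂ z z) / 2 * (-1)
      - Complex.exp (inner ℂ z z) / 2) * Complex.I_mul_I
  · simp only [h, Ne.symm h, if_false]
    linear_combination ((conj (z i) - z i) * z j * Complex.exp (inner ℂ z z) / 2 * (-1))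
      * Complex.I_mul_I

/-- The Hermitian form with potential `exp |z|²`, in invariant form. -/
def expForm {V : Type*} [NormedAddCommGroup V] [InnerProductSpace ℂ V] (z u v : V) : ℂ :=
  Complex.exp (inner ℂ z z) * (inner ℂ v u + inner ℂ z u * inner ℂ v z)

theorem potentialMetric_exp_apply (z u v : Cn n) :
    potentialMetric n Real.exp z u v = (expForm z u v).re := by
  rw [potentialMetric_apply, expForm]
  congr 1
  have h : ∀ i j : Fin n, coeff n Real.exp i j z * (u i * conj (v j)) =
      Complex.exp (inner ℂ z z) * ((if i = j then u i * conj (v j) else 0)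
        + (conj (z i) * u i) * (conj (v j) * z j)) := by
    intro i j
    rw [coeff_exp]
    split_ifs <;> ring
  simp only [h, ← Finset.mul_sum, Finset.sum_add_distrib, Finset.sum_ite_eq, Finset.mem_univ,
    if_true, ← Finset.sum_mul]
  simp [PiLp.inner_apply, mul_comm]

theorem contDiff_potentialMetric_exp (n : ℕ) : ContDiff ℝ ∞ (potentialMetric n Real.exp) := by
  rw [contDiff_clm_apply_iff]
  intro u
  rw [contDiff_clm_apply_iff]
  intro v
  simp only [potentialMetric_exp_apply]
  have h : ContDiff ℝ ∞ fun z : Cn n => expForm z u v :=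
    contDiff_cexp_inner_self.mul (contDiff_const.add
      ((contDiff_id.inner ℂ contDiff_const).mul (contDiff_const.inner ℂ contDiff_id)))
  exact Complex.reCLM.contDiff.comp h

theorem hasDerivAt_expForm_line {V : Type*} [NormedAddCommGroup V] [InnerProductSpace ℂ V]
    (z w u v : V) :
    HasDerivAt (fun t : ℝ => expForm (z + t • w) u v)
      (Complex.exp (inner ℂ z z) * ((inner ℂ w z + inner ℂ z w) *
        (inner ℂ v u + inner ℂ z u * inner ℂ v z) +
        (inner ℂ w u * inner ℂ v z + inner ℂ z u * inner ℂ v w))) 0 := by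
  refine ((hasDerivAt_cexp_inner_self_line z w).mul (((hasDerivAt_inner_line_left z w u).mul
    (hasDerivAt_inner_line_right z w v)).const_add (inner ℂ v u))).congr_deriv ?_
  simp only [zero_smul, add_zero, Pi.mul_apply]
  ring

/-- Reduces the derivative of an operator-valued map to that of its values on constant fields, where
the line derivatives apply. -/
theorem fderiv_clm_apply₂ {E F G H : Type*} [NormedAddCommGroup E] [NormedSpace ℝ E]
    [NormedAddCommGroup F] [NormedSpace ℝ F] [NormedAddCommGroup G] [NormedSpace ℝ G]
    [NormedAddCommGroup H] [NormedSpace ℝ H] {g : E → F →L[ℝ] G →L[ℝ] H} {x : E}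
    (hg : DifferentiableAt ℝ g x) (u : E) (v : F) (w : G) :
    fderiv ℝ g x u v w = fderiv ℝ (fun y => g y v w) x u := by
  rw [fderiv_clm_apply (hg.clm_apply (differentiableAt_const v)) (differentiableAt_const w),
    fderiv_clm_apply hg (differentiableAt_const v)]
  simp

theorem fderiv_potentialMetric_exp (z w u v : Cn n) :
    fderiv ℝ (potentialMetric n Real.exp) z w u v =
      (Complex.exp (inner ℂ z z) * ((inner ℂ w z + inner ℂ z w) *
        (inner ℂ v u + inner ℂ z u * inner ℂ v z) +
        (inner ℂ w u * inner ℂ v z + inner ℂ z u * inner ℂ v w))).re := by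
  have hd : DifferentiableAt ℝ (potentialMetric n Real.exp) z :=
    (contDiff_potentialMetric_exp n).differentiable (by simp) z
  rw [fderiv_clm_apply₂ hd]
  refine fderiv_apply_of_hasDerivAt_line ?_ ?_
  · exact (hd.clm_apply (differentiableAt_const u)).clm_apply (differentiableAt_const v)
  · simp only [potentialMetric_exp_apply]
    exact Complex.reCLM.hasFDerivAt.comp_hasDerivAt (0 : ℝ) (hasDerivAt_expForm_line z w u v)

theorem potentialMetric_exp_self (z u : Cn n) :
    potentialMetric n Real.exp z u u =
      Real.exp (‖z‖ ^ 2) * (‖u‖ ^ 2 + ‖inner ℂ z u‖ ^ 2) := by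
  rw [potentialMetric_exp_apply, expForm, cexp_inner_self, Complex.re_ofReal_mul,
    ← inner_conj_symm u z, Complex.mul_conj, inner_self_eq_norm_sq_to_K, ← Complex.sq_norm]
  norm_cast

theorem isRiemannianMetric_potentialMetric_exp (n : ℕ) :
    IsRiemannianMetric (potentialMetric n Real.exp) where
  smooth := contDiff_potentialMetric_exp n
  symm z u v := by
    rw [potentialMetric_exp_apply, potentialMetric_exp_apply, ← Complex.conj_re (expForm z v u)]
    simp only [expForm, cexp_inner_self, map_mul, map_add, inner_conj_symm, Complex.conj_ofReal]
    ring_nf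
  pos z u hu := by
    rw [potentialMetric_exp_self]
    have := norm_pos_iff.2 hu
    positivity

theorem isKahlerMetric_potentialMetric_exp (n : ℕ) :
    IsKahlerMetric (potentialMetric n Real.exp) where
  riemannian := isRiemannianMetric_potentialMetric_exp n
  hermitian z u v := by
    rw [potentialMetric_exp_apply, potentialMetric_exp_apply, expForm, expForm]
    congr 2
    simp only [inner_smul_left, inner_smul_right, Complex.conj_I]
    linear_combination (-(inner ℂ v u + inner ℂ z u * inner ℂ v z)) * Complex.I_mul_I
  closed z u v w := by
    -- Each inner product and its reverse are conjugate. Once one order is fixed and real and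
    -- imaginary parts are split, the cyclic sum is a polynomial identity over `ℝ`.
    simp only [fderiv_potentialMetric_exp, cexp_inner_self, inner_smul_right,
      Complex.re_ofReal_mul, ← mul_add, ← inner_conj_symm u z, ← inner_conj_symm v z,
      ← inner_conj_symm w z, ← inner_conj_symm v u, ← inner_conj_symm w v, ← inner_conj_symm w u]
    simp only [Complex.add_re, Complex.mul_re, Complex.add_im, Complex.mul_im, Complex.I_re,
      Complex.I_im, Complex.conj_re, Complex.conj_im]
    ring

/-- The Christoffel map of the metric with potential `exp |z|²`. -/
def expChristoffel {V : Type*} [NormedAddCommGroup V] [InnerProductSpace ℂ V] (z u v : V) : V :=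
  inner ℂ z v • u + inner ℂ z u • v - (inner ℂ z u * inner ℂ z v / (1 + inner ℂ z z)) • z

/-- The denominator `1 + |z|²` comes from inverting the rank-one perturbation: `(1 + z z*)⁻¹ = 1 - z
z*/(1 + |z|²)`. The right-hand side is the holomorphic derivative of the form, half the Koszul
expression after taking real parts. -/
theorem expForm_expChristoffel {V : Type*} [NormedAddCommGroup V] [InnerProductSpace ℂ V]
    (z u v w : V) :
    expForm z (expChristoffel z u v) w = Complex.exp (inner ℂ z z) *
      (inner ℂ z v * inner ℂ w u + inner ℂ z u * inner ℂ w v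
        + inner ℂ z u * inner ℂ z v * inner ℂ w z) := by
  have := one_add_inner_self_ne_zero z
  simp only [expForm, expChristoffel, inner_add_right, inner_sub_right, inner_smul_right]
  field_simp
  ring

theorem eq_of_metric_apply_eq {E : Type*} [NormedAddCommGroup E] [NormedSpace ℝ E]
    {g : E → E →L[ℝ] E →L[ℝ] ℝ} (hg : IsRiemannianMetric g) {x u v : E}
    (h : ∀ w, g x u w = g x v w) : u = v := by
  by_contra hne
  refine (hg.pos x (u - v) (sub_ne_zero.2 hne)).ne' ?_
  rw [map_sub (g x), sub_apply, h, sub_self]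

theorem christoffel_potentialMetric_exp (z u v : Cn n) :
    christoffel (potentialMetric n Real.exp) z u v = expChristoffel z u v := by
  have hg := isRiemannianMetric_potentialMetric_exp n
  refine eq_of_metric_apply_eq hg (x := z) fun w => ?_
  refine mul_left_cancel₀ (two_ne_zero (α := ℝ)) ?_
  rw [christoffel_spec hg, koszul_apply, potentialMetric_exp_apply, expForm_expChristoffel]
  simp only [fderiv_potentialMetric_exp, cexp_inner_self,
      Complex.re_ofReal_mul, ← mul_add, ← mul_sub, ← inner_conj_symm u z, ← inner_conj_symm v z,
      ← inner_conj_symm w z, ← inner_conj_symm v u, ← inner_conj_symm w v, ← inner_conj_symm w u]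
  simp only [Complex.add_re, Complex.mul_re, Complex.add_im, Complex.mul_im,
      Complex.conj_re, Complex.conj_im]
  ring

end Potential

/-! ### The curvature tensor and the sectional curvature bounds. -/

section Curvature

variable {n : ℕ}

theorem contDiff_expChristoffel {V : Type*} [NormedAddCommGroup V] [InnerProductSpace ℂ V]
    (u v : V) : ContDiff ℝ ∞ fun z : V => expChristoffel z u v := by
  have hi : ∀ w : V, ContDiff ℝ ∞ fun z : V => inner ℂ z w :=
    fun w => contDiff_id.inner ℂ contDiff_const
  have hs : ContDiff ℝ ∞ fun z : V => inner ℂ z z := contDiff_id.inner ℂ contDiff_id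
  have hq : ContDiff ℝ ∞ fun z : V => (1 + inner ℂ z z)⁻¹ :=
    (contDiff_const.add hs).inv one_add_inner_self_ne_zero
  simp only [expChristoffel, div_eq_mul_inv]
  exact (((hi v).smul contDiff_const).add ((hi u).smul contDiff_const)).sub
    ((((hi u).mul (hi v)).mul hq).smul contDiff_id)

theorem contDiff_christoffel_potentialMetric_exp (n : ℕ) :
    ContDiff ℝ ∞ (christoffel (potentialMetric n Real.exp)) := by
  rw [contDiff_clm_apply_iff]
  intro u
  rw [contDiff_clm_apply_iff]
  intro v
  simp only [christoffel_potentialMetric_exp]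
  exact contDiff_expChristoffel u v

theorem hasDerivAt_expChristoffel_line {V : Type*} [NormedAddCommGroup V] [InnerProductSpace ℂ V]
    (z w u v : V) :
    HasDerivAt (fun t : ℝ => expChristoffel (z + t • w) u v)
      (inner ℂ w v • u + inner ℂ w u • v
        - ((inner ℂ w u * inner ℂ z v + inner ℂ z u * inner ℂ w v) / (1 + inner ℂ z z)
          - inner ℂ z u * inner ℂ z v * (inner ℂ w z + inner ℂ z w) / (1 + inner ℂ z z) ^ 2) • z
        - (inner ℂ z u * inner ℂ z v / (1 + inner ℂ z z)) • w) 0 := by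
  have hq := one_add_inner_self_ne_zero z
  have hi := hasDerivAt_inner_line_left z w
  have hl : HasDerivAt (fun t : ℝ => z + t • w) w 0 := by
    simpa using ((hasDerivAt_id (0 : ℝ)).smul_const w).const_add z
  have hs := (hasDerivAt_inner_self_line z w).const_add 1
  refine ((((hi v).smul_const u).add ((hi u).smul_const v)).sub
    ((((hi u).mul (hi v)).div hs (by simpa using hq)).smul hl)).congr_deriv ?_
  simp only [zero_smul, add_zero, Pi.mul_apply, Pi.div_apply]
  match_scalars <;> field_simp

theorem fderiv_christoffel_potentialMetric_exp (z w u v : Cn n) :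
    fderiv ℝ (christoffel (potentialMetric n Real.exp)) z w u v =
      inner ℂ w v • u + inner ℂ w u • v
        - ((inner ℂ w u * inner ℂ z v + inner ℂ z u * inner ℂ w v) / (1 + inner ℂ z z)
          - inner ℂ z u * inner ℂ z v * (inner ℂ w z + inner ℂ z w) / (1 + inner ℂ z z) ^ 2) • z
        - (inner ℂ z u * inner ℂ z v / (1 + inner ℂ z z)) • w := by
  rw [fderiv_clm_apply₂ ((contDiff_christoffel_potentialMetric_exp n).differentiable (by simp) z)]
  simp only [christoffel_potentialMetric_exp]
  exact fderiv_apply_of_hasDerivAt_line ((contDiff_expChristoffel u v).differentiable (by simp) z)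
    (hasDerivAt_expChristoffel_line z w u v)

/-- The antiholomorphic derivative of `expChristoffel` in the direction `w`. -/
def expChristoffelBar {V : Type*} [NormedAddCommGroup V] [InnerProductSpace ℂ V]
    (z w u v : V) : V :=
  inner ℂ w v • u + inner ℂ w u • v
    - ((inner ℂ w u * inner ℂ z v + inner ℂ z u * inner ℂ w v) / (1 + inner ℂ z z)
      - inner ℂ z u * inner ℂ z v * inner ℂ w z / (1 + inner ℂ z z) ^ 2) • z

/-- The antisymmetrised holomorphic derivatives cancel the commutator of the Christoffel terms, so
only the part conjugate-linear in the direction of differentiation survives. -/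
theorem curvature_potentialMetric_exp (z u v w : Cn n) :
    curvature (potentialMetric n Real.exp) z u v w =
      expChristoffelBar z u v w - expChristoffelBar z v u w := by
  have hq := one_add_inner_self_ne_zero z
  simp only [curvature, fderiv_christoffel_potentialMetric_exp, christoffel_potentialMetric_exp,
    expChristoffel, expChristoffelBar, inner_add_right, inner_sub_right, inner_smul_right]
  match_scalars <;> field_simp <;> ring

/-- Pairing with the metric clears the rank-one correction and exhibits the Kähler symmetries, in
`a, b` and in `c, d`. -/
theorem expForm_expChristoffelBar {V : Type*} [NormedAddCommGroup V] [InnerProductSpace ℂ V]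
    (z a b c d : V) :
    expForm z (expChristoffelBar z d a b) c = Complex.exp (inner ℂ z z) *
      (inner ℂ c a * inner ℂ d b + inner ℂ d a * inner ℂ c b
        + inner ℂ z a * inner ℂ z b * inner ℂ c z * inner ℂ d z / (1 + inner ℂ z z)) := by
  have hq := one_add_inner_self_ne_zero z
  simp only [expForm, expChristoffelBar, inner_add_right, inner_sub_right, inner_smul_right]
  field_simp
  ring

theorem metric_curvature_potentialMetric_exp (z u v : Cn n) :
    potentialMetric n Real.exp z (curvature (potentialMetric n Real.exp) z u v v) u =
      -(Real.exp (‖z‖ ^ 2) * (‖u‖ ^ 2 * ‖v‖ ^ 2 - (inner ℂ u v).re ^ 2 + 3 * (inner ℂ u v).im ^ 2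
        + 2 * (conj (inner ℂ z u) * inner ℂ z v).im ^ 2 / (1 + ‖z‖ ^ 2))) := by
  rw [curvature_potentialMetric_exp, map_sub, sub_apply, potentialMetric_exp_apply,
    potentialMetric_exp_apply, expForm_expChristoffelBar, expForm_expChristoffelBar,
    cexp_inner_self, Complex.re_ofReal_mul, Complex.re_ofReal_mul, ← mul_sub, ← mul_neg]
  congr 1
  rw [one_add_inner_self, inner_self_eq_ofReal_norm_sq u, inner_self_eq_ofReal_norm_sq v,
    ← inner_conj_symm u z, ← inner_conj_symm v z, ← inner_conj_symm v u]
  simp only [Complex.add_re, Complex.mul_re, Complex.mul_im, Complex.div_ofReal_re,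
      Complex.conj_re, Complex.conj_im, Complex.ofReal_re, Complex.ofReal_im]
  field_simp
  ring

theorem area_potentialMetric_exp (z u v : Cn n) :
    potentialMetric n Real.exp z u u * potentialMetric n Real.exp z v v
        - potentialMetric n Real.exp z u v ^ 2 =
      Real.exp (‖z‖ ^ 2) ^ 2 * ((‖u‖ ^ 2 * ‖v‖ ^ 2 - (inner ℂ u v).re ^ 2)
        + (‖u‖ ^ 2 * ‖inner ℂ z v‖ ^ 2 + ‖v‖ ^ 2 * ‖inner ℂ z u‖ ^ 2
          - 2 * (inner ℂ u v).re * (conj (inner ℂ z u) * inner ℂ z v).re)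
        + (conj (inner ℂ z u) * inner ℂ z v).im ^ 2) := by
  rw [potentialMetric_exp_self, potentialMetric_exp_self, potentialMetric_exp_apply, expForm,
    cexp_inner_self, Complex.re_ofReal_mul, ← inner_conj_symm v z, ← inner_conj_symm v u]
  simp only [Complex.add_re, Complex.mul_re, Complex.mul_im,
      Complex.conj_re, Complex.conj_im, Complex.sq_norm, Complex.normSq_apply]
  ring

/-- By Cauchy–Schwarz the expression is at least `(‖u‖‖b‖ - ‖v‖‖a‖)²`. -/
theorem cross_term_nonneg {V : Type*} [NormedAddCommGroup V] [InnerProductSpace ℂ V] (u v : V)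
    (a b : ℂ) : 0 ≤ ‖u‖ ^ 2 * ‖b‖ ^ 2 + ‖v‖ ^ 2 * ‖a‖ ^ 2
      - 2 * (inner ℂ u v).re * (conj a * b).re := by
  have h1 : |(inner ℂ u v).re| ≤ ‖u‖ * ‖v‖ :=
    (Complex.abs_re_le_norm _).trans (norm_inner_le_norm u v)
  have h2 : |(conj a * b).re| ≤ ‖a‖ * ‖b‖ := by
    simpa using Complex.abs_re_le_norm (conj a * b)
  have h3 : (inner ℂ u v).re * (conj a * b).re ≤ (‖u‖ * ‖v‖) * (‖a‖ * ‖b‖) := by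
    refine (le_abs_self _).trans ?_
    rw [abs_mul]
    gcongr
  nlinarith [sq_nonneg (‖u‖ * ‖b‖ - ‖v‖ * ‖a‖)]

theorem re_sq_add_im_sq_inner_le {V : Type*} [NormedAddCommGroup V] [InnerProductSpace ℂ V]
    (u v : V) : (inner ℂ u v).re ^ 2 + (inner ℂ u v).im ^ 2 ≤ ‖u‖ ^ 2 * ‖v‖ ^ 2 := by
  have h := norm_inner_le_norm (𝕜 := ℂ) u v
  have h2 : ‖inner ℂ u v‖ ^ 2 ≤ (‖u‖ * ‖v‖) ^ 2 := by gcongr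
  rw [Complex.sq_norm, Complex.normSq_apply] at h2
  nlinarith

theorem re_inner_sq_lt {V : Type*} [NormedAddCommGroup V] [InnerProductSpace ℂ V]
    {u v : V} (h : LinearIndependent ℝ ![u, v]) :
    (inner ℂ u v).re ^ 2 < ‖u‖ ^ 2 * ‖v‖ ^ 2 := by
  rw [LinearIndependent.pair_iff] at h
  have hu : u ≠ 0 := fun h0 => by simpa using h 1 0 (by simp [h0])
  have hpos := norm_pos_iff.2 hu
  -- Gram–Schmidt for the real inner product, scaled by `‖u‖²` to avoid division; the squared norm
  -- of this vector is `‖u‖²` times the Gram determinant.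
  have hw : ‖u‖ ^ 2 • v - (inner ℂ u v).re • u ≠ 0 := fun h0 => by
    have := h (-(inner ℂ u v).re) (‖u‖ ^ 2) (by rw [← h0]; module)
    exact absurd this.2 (by positivity)
  have hexp : ‖‖u‖ ^ 2 • v - (inner ℂ u v).re • u‖ ^ 2
      = ‖u‖ ^ 2 * (‖u‖ ^ 2 * ‖v‖ ^ 2 - (inner ℂ u v).re ^ 2) := by
    rw [norm_sub_sq (𝕜 := ℂ), ← Complex.coe_smul, ← Complex.coe_smul, inner_smul_left,
      inner_smul_right, norm_smul, norm_smul, ← inner_conj_symm v u]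
    simp only [Complex.norm_real, Complex.conj_ofReal, mul_pow, RCLike.re_to_complex,
      Complex.re_ofReal_mul, Complex.conj_re, Real.norm_eq_abs, sq_abs]
    ring
  have h1 : 0 < ‖‖u‖ ^ 2 • v - (inner ℂ u v).re • u‖ ^ 2 := by
    have := norm_pos_iff.2 hw
    positivity
  rw [hexp] at h1
  have := pos_of_mul_pos_right h1 (by positivity)
  linarith

theorem area_potentialMetric_exp_pos {u v : Cn n} (h : LinearIndependent ℝ ![u, v]) (z : Cn n) :
    0 < potentialMetric n Real.exp z u u * potentialMetric n Real.exp z v v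
        - potentialMetric n Real.exp z u v ^ 2 := by
  rw [area_potentialMetric_exp]
  have h1 := re_inner_sq_lt h
  have h2 := cross_term_nonneg u v (inner ℂ z u) (inner ℂ z v)
  refine mul_pos (by positivity) ?_
  nlinarith [sq_nonneg (conj (inner ℂ z u) * inner ℂ z v).im]

/-- Since `I² ≤ S`, the curvature term is at most `4S + 2J²`, and the area term times 4 dominates
it. Kept free of quotients so that it also covers dependent `u, v`, as the Ricci trace requires. -/
theorem metric_curvature_potentialMetric_exp_ge (z u v : Cn n) :
    -(4 * Real.exp (-‖z‖ ^ 2)) * (potentialMetric n Real.exp z u u * potentialMetric n Real.exp z v v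
        - potentialMetric n Real.exp z u v ^ 2) ≤
      potentialMetric n Real.exp z (curvature (potentialMetric n Real.exp) z u v v) u := by
  rw [area_potentialMetric_exp, metric_curvature_potentialMetric_exp, Real.exp_neg]
  have hE := Real.exp_pos (‖z‖ ^ 2)
  have h1 := re_sq_add_im_sq_inner_le u v
  have h2 := cross_term_nonneg u v (inner ℂ z u) (inner ℂ z v)
  have h3 : 2 * (conj (inner ℂ z u) * inner ℂ z v).im ^ 2 / (1 + ‖z‖ ^ 2)
      ≤ 2 * (conj (inner ℂ z u) * inner ℂ z v).im ^ 2 :=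
    div_le_self (by positivity) (by nlinarith [sq_nonneg ‖z‖])
  have h4 := sq_nonneg (conj (inner ℂ z u) * inner ℂ z v).im
  have hI : ∀ x : ℝ, 4 * (Real.exp (‖z‖ ^ 2))⁻¹ * (Real.exp (‖z‖ ^ 2) ^ 2 * x)
      = Real.exp (‖z‖ ^ 2) * (4 * x) := fun x => by field_simp
  rw [neg_mul, neg_le_neg_iff, hI]
  exact mul_le_mul_of_nonneg_left (by linarith) hE.le

theorem sectionalCurvature_potentialMetric_exp_ge {u v : Cn n}
    (h : LinearIndependent ℝ ![u, v]) (z : Cn n) :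
    -(4 * Real.exp (-‖z‖ ^ 2)) ≤ sectionalCurvature (potentialMetric n Real.exp) z u v := by
  rw [sectionalCurvature, le_div_iff₀ (area_potentialMetric_exp_pos h z)]
  exact metric_curvature_potentialMetric_exp_ge z u v

theorem negativeSectional_potentialMetric_exp (n : ℕ) :
    NegativeSectional (potentialMetric n Real.exp) := by
  intro z u v h
  refine div_neg_of_neg_of_pos ?_ (area_potentialMetric_exp_pos h z)
  rw [metric_curvature_potentialMetric_exp, neg_lt_zero]
  have h1 := sub_pos.2 (re_inner_sq_lt h)
  positivity

theorem sectionalBoundedBelow_potentialMetric_exp (n : ℕ) :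
    SectionalBoundedBelow (potentialMetric n Real.exp) := by
  -- Any constant below `-4` gives the strict inequality.
  refine ⟨-5, fun z u v h => ?_⟩
  have h1 := sectionalCurvature_potentialMetric_exp_ge h z
  have h2 : Real.exp (-‖z‖ ^ 2) ≤ 1 := Real.exp_le_one_iff.2 (by simp)
  linarith

theorem exists_linearIndependent_pair {n : ℕ} (hn : 1 ≤ n) :
    ∃ u v : Cn n, LinearIndependent ℝ ![u, v] := by
  -- A complex coordinate line; the decay estimate holds on every plane, so any choice serves.
  refine ⟨EuclideanSpace.single ⟨0, hn⟩ 1, EuclideanSpace.single ⟨0, hn⟩ Complex.I, ?_⟩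
  rw [LinearIndependent.pair_iff]
  intro s t h
  have h0 := congrArg (fun x : Cn n => x ⟨0, hn⟩) h
  simp only [PiLp.add_apply, PiLp.smul_apply, PiLp.single_apply, if_true, PiLp.zero_apply] at h0
  exact ⟨by simpa using congrArg Complex.re h0, by simpa using congrArg Complex.im h0⟩

end Curvature

/-! ### Completeness by comparison with the Euclidean metric. -/

section Completeness

variable {E : Type*} [NormedAddCommGroup E] [NormedSpace ℝ E]

theorem edist_le_pathLength [CompleteSpace E] {g : E → E →L[ℝ] E →L[ℝ] ℝ}
    (hg : ∀ x v, ‖v‖ ^ 2 ≤ g x v v) {γ : ℝ → E} (hγ : ContDiff ℝ 1 γ) :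
    edist (γ 0) (γ 1) ≤ pathLength g γ := by
  have hcont : Continuous (deriv γ) := hγ.continuous_deriv le_rfl
  have hint : ∫ t in (0 : ℝ)..1, deriv γ t = γ 1 - γ 0 :=
    intervalIntegral.integral_deriv_eq_sub
      (fun x _ => hγ.differentiable one_ne_zero x) (hcont.intervalIntegrable 0 1)
  rw [edist_comm, edist_eq_enorm_sub, ← hint, intervalIntegral.integral_of_le zero_le_one,
    ← MeasureTheory.integral_Icc_eq_integral_Ioc]
  refine (MeasureTheory.enorm_integral_le_lintegral_enorm _).trans ?_
  refine MeasureTheory.lintegral_mono fun t => ?_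
  rw [← ofReal_norm]
  exact ENNReal.ofReal_le_ofReal (Real.le_sqrt_of_sq_le (hg _ _))

theorem edist_le_riemDist [CompleteSpace E] {g : E → E →L[ℝ] E →L[ℝ] ℝ}
    (hg : ∀ x v, ‖v‖ ^ 2 ≤ g x v v) (x y : E) : edist x y ≤ riemDist g x y := by
  refine le_iInf fun γ => le_iInf fun hγ => le_iInf fun h0 => le_iInf fun h1 => ?_
  rw [← h0, ← h1]
  exact edist_le_pathLength hg hγ

theorem riemDist_le_pathLength (g : E → E →L[ℝ] E →L[ℝ] ℝ) {γ : ℝ → E} (hγ : ContDiff ℝ 1 γ)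
    {x y : E} (h0 : γ 0 = x) (h1 : γ 1 = y) : riemDist g x y ≤ pathLength g γ :=
  iInf₂_le_of_le γ hγ (iInf₂_le_of_le h0 h1 le_rfl)

theorem riemDist_le_of_segment {g : E → E →L[ℝ] E →L[ℝ] ℝ} {C : ℝ} (x y : E)
    (hg : ∀ w ∈ segment ℝ x y, ∀ v, g w v v ≤ C ^ 2 * ‖v‖ ^ 2) (hC : 0 ≤ C) :
    riemDist g x y ≤ ENNReal.ofReal (C * ‖y - x‖) := by
  let γ : ℝ → E := fun t => x + t • (y - x)
  have hγ : ContDiff ℝ 1 γ := contDiff_const.add (contDiff_id.smul contDiff_const)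
  have hd : ∀ t, deriv γ t = y - x := fun t => by
    have : HasDerivAt γ ((1 : ℝ) • (y - x)) t :=
      ((hasDerivAt_id t).smul_const (y - x)).const_add x
    rw [this.deriv, one_smul]
  refine (riemDist_le_pathLength g hγ (by simp [γ]) (by simp [γ])).trans ?_
  have hb : ∀ t ∈ Set.Icc (0 : ℝ) 1,
      ENNReal.ofReal (√(g (γ t) (deriv γ t) (deriv γ t))) ≤ ENNReal.ofReal (C * ‖y - x‖) := by
    intro t ht
    refine ENNReal.ofReal_le_ofReal (Real.sqrt_le_iff.2 ⟨by positivity, ?_⟩)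
    rw [hd, mul_pow]
    refine hg _ ?_ _
    rw [segment_eq_image']
    exact ⟨t, ht, rfl⟩
  refine (MeasureTheory.setLIntegral_mono' measurableSet_Icc hb).trans ?_
  simp

/-- A Cauchy sequence for `riemDist` is Cauchy in norm, hence has a norm limit. Near that limit `g`
is bounded by compactness, so lengths of straight segments force convergence in `riemDist` too. -/
theorem isCompleteMetric_of_norm_sq_le [FiniteDimensional ℝ E] {g : E → E →L[ℝ] E →L[ℝ] ℝ}
    (hc : Continuous g) (hg : ∀ x v, ‖v‖ ^ 2 ≤ g x v v) : IsCompleteMetric g := by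
  have : CompleteSpace E := FiniteDimensional.complete ℝ E
  have : ProperSpace E := FiniteDimensional.proper ℝ E
  intro s hs
  have hcs : CauchySeq s := by
    rw [EMetric.cauchySeq_iff]
    intro ε hε
    obtain ⟨N, hN⟩ := hs ε hε
    exact ⟨N, fun m hm k hk => (edist_le_riemDist hg _ _).trans_lt (hN m hm k hk)⟩
  obtain ⟨x, hx⟩ := cauchySeq_tendsto_of_complete hcs
  refine ⟨x, ?_⟩
  obtain ⟨K, hK⟩ := (isCompact_closedBall x 1).exists_bound_of_continuousOn
    (f := g) hc.continuousOn
  have hK0 : 0 ≤ K := (norm_nonneg _).trans (hK x (by simp))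
  have hbound : ∀ᶠ m in Filter.atTop,
      riemDist g (s m) x ≤ ENNReal.ofReal (√K * ‖x - s m‖) := by
    filter_upwards [hx (Metric.closedBall_mem_nhds x one_pos)] with m hm
    refine riemDist_le_of_segment _ _ (fun w hw v => ?_) (Real.sqrt_nonneg K)
    have hwb : w ∈ Metric.closedBall x 1 :=
      (convex_closedBall x 1).segment_subset hm (by simp) hw
    rw [Real.sq_sqrt hK0]
    calc g w v v ≤ ‖g w v v‖ := le_abs_self _
      _ ≤ ‖g w‖ * ‖v‖ * ‖v‖ := (g w).le_opNorm₂ v v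
      _ ≤ K * ‖v‖ * ‖v‖ := by gcongr; exact hK w hwb
      _ = K * ‖v‖ ^ 2 := by ring
  refine tendsto_of_tendsto_of_tendsto_of_le_of_le' tendsto_const_nhds ?_
    (Filter.Eventually.of_forall fun _ => zero_le) hbound
  have h0 : Filter.Tendsto (fun m => √K * ‖x - s m‖) Filter.atTop (𝓝 (√K * ‖x - x‖)) :=
    (tendsto_const_nhds.sub hx).norm.const_mul _
  simpa using ENNReal.tendsto_ofReal h0

theorem isCompleteMetric_potentialMetric_exp (n : ℕ) :
    IsCompleteMetric (potentialMetric n Real.exp) := by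
  refine isCompleteMetric_of_norm_sq_le (contDiff_potentialMetric_exp n).continuous fun z v => ?_
  rw [potentialMetric_exp_self]
  have h1 : 1 ≤ Real.exp (‖z‖ ^ 2) := Real.one_le_exp (by positivity)
  nlinarith [sq_nonneg ‖v‖, sq_nonneg ‖inner ℂ z v‖]

end Completeness

/-! ### Naturality under complex linear isomorphisms. -/

section Pullback

variable {E F : Type*} [NormedAddCommGroup E] [NormedSpace ℂ E] [NormedAddCommGroup F]
  [NormedSpace ℂ F]

theorem fderiv_comp_equiv_apply {G : Type*} [NormedAddCommGroup G] [NormedSpace ℝ G]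
    (L : F ≃L[ℂ] E) {f : E → G} {x : F} (hf : DifferentiableAt ℝ f (L x)) (u : F) :
    fderiv ℝ (fun y => f (L y)) x u = fderiv ℝ f (L x) (L u) := by
  have hL : HasFDerivAt L ((L : F →L[ℂ] E).restrictScalars ℝ) x :=
    ((L : F →L[ℂ] E).restrictScalars ℝ).hasFDerivAt
  exact congrArg (fun T : F →L[ℝ] G => T u) (hf.hasFDerivAt.comp x hL).fderiv

theorem contDiff_pullback [FiniteDimensional ℝ F] (L : F ≃L[ℂ] E) {g : E → E →L[ℝ] E →L[ℝ] ℝ}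
    (hg : ContDiff ℝ ∞ g) : ContDiff ℝ ∞ (pullback L g) := by
  have hL : ContDiff ℝ ∞ L := ((L : F →L[ℂ] E).restrictScalars ℝ).contDiff
  rw [contDiff_clm_apply_iff]
  intro u
  rw [contDiff_clm_apply_iff]
  intro v
  simp only [pullback_apply]
  exact ((hg.comp hL).clm_apply contDiff_const).clm_apply contDiff_const

theorem fderiv_pullback [FiniteDimensional ℝ F] (L : F ≃L[ℂ] E) {g : E → E →L[ℝ] E →L[ℝ] ℝ}
    (hg : ContDiff ℝ ∞ g) (x u v w : F) :
    fderiv ℝ (pullback L g) x u v w = fderiv ℝ g (L x) (L u) (L v) (L w) := by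
  have hd : DifferentiableAt ℝ g (L x) := hg.differentiable (by simp) _
  rw [fderiv_clm_apply₂ ((contDiff_pullback L hg).differentiable (by simp) x),
    fderiv_clm_apply₂ hd]
  simp only [pullback_apply]
  exact fderiv_comp_equiv_apply L (f := fun y => g y (L v) (L w))
    ((hd.clm_apply (differentiableAt_const _)).clm_apply (differentiableAt_const _)) u

theorem IsRiemannianMetric.pullback [FiniteDimensional ℝ F] {g : E → E →L[ℝ] E →L[ℝ] ℝ}
    (hg : IsRiemannianMetric g) (L : F ≃L[ℂ] E) : IsRiemannianMetric (pullback L g) where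
  smooth := contDiff_pullback L hg.smooth
  symm x u v := by simp only [pullback_apply, hg.symm (L x) (L u)]
  pos x u hu := by
    rw [pullback_apply]
    exact hg.pos _ _ (by simpa using hu)

theorem IsKahlerMetric.pullback [FiniteDimensional ℝ F] {g : E → E →L[ℝ] E →L[ℝ] ℝ}
    (hg : IsKahlerMetric g) (L : F ≃L[ℂ] E) : IsKahlerMetric (pullback L g) where
  riemannian := hg.riemannian.pullback L
  hermitian x u v := by simp only [pullback_apply, map_smul, hg.hermitian]
  closed x u v w := by
    simp only [fderiv_pullback L hg.riemannian.smooth, map_smul, hg.closed]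

/-- A linear map has no second derivative, so no inhomogeneous term appears; both sides satisfy the
same Koszul identity, and the metric is nondegenerate. -/
theorem christoffel_pullback [FiniteDimensional ℝ E] [FiniteDimensional ℝ F]
    {g : E → E →L[ℝ] E →L[ℝ] ℝ} (hg : IsRiemannianMetric g) (L : F ≃L[ℂ] E) (x u v : F) :
    christoffel (pullback L g) x u v = L.symm (christoffel g (L x) (L u) (L v)) := by
  refine eq_of_metric_apply_eq (hg.pullback L) (x := x) fun w => ?_
  refine mul_left_cancel₀ (two_ne_zero (α := ℝ)) ?_
  rw [christoffel_spec (hg.pullback L), pullback_apply, ContinuousLinearEquiv.apply_symm_apply,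
    christoffel_spec hg, koszul_apply, koszul_apply]
  simp only [fderiv_pullback L hg.smooth]

theorem fderiv_christoffel_pullback [FiniteDimensional ℝ E] [FiniteDimensional ℝ F]
    {g : E → E →L[ℝ] E →L[ℝ] ℝ} (hg : IsRiemannianMetric g) (hΓ : ContDiff ℝ ∞ (christoffel g))
    (L : F ≃L[ℂ] E) (x u v w : F) :
    fderiv ℝ (christoffel (pullback L g)) x u v w =
      L.symm (fderiv ℝ (christoffel g) (L x) (L u) (L v) (L w)) := by
  have hL : ContDiff ℝ ∞ L := ((L : F →L[ℂ] E).restrictScalars ℝ).contDiff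
  have hL' : ContDiff ℝ ∞ L.symm := ((L.symm : E →L[ℂ] F).restrictScalars ℝ).contDiff
  have hs : ContDiff ℝ ∞ (christoffel (pullback L g)) := by
    rw [contDiff_clm_apply_iff]
    intro u
    rw [contDiff_clm_apply_iff]
    intro v
    simp only [christoffel_pullback hg]
    exact hL'.comp (((hΓ.comp hL).clm_apply contDiff_const).clm_apply contDiff_const)
  have hd : DifferentiableAt ℝ (christoffel g) (L x) := hΓ.differentiable (by simp) _
  have hd' : DifferentiableAt ℝ (fun y => christoffel g y (L v) (L w)) (L x) :=
    (hd.clm_apply (differentiableAt_const _)).clm_apply (differentiableAt_const _)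
  rw [fderiv_clm_apply₂ (hs.differentiable (by simp) x), fderiv_clm_apply₂ hd]
  simp only [christoffel_pullback hg]
  rw [fderiv_comp_equiv_apply L (f := fun y => L.symm (christoffel g y (L v) (L w)))
    ((hL'.differentiable (by simp) _).comp _ hd')]
  have hc : HasFDerivAt L.symm ((L.symm : E →L[ℂ] F).restrictScalars ℝ)
      (christoffel g (L x) (L v) (L w)) :=
    ((L.symm : E →L[ℂ] F).restrictScalars ℝ).hasFDerivAt
  have := (hc.comp (L x) hd'.hasFDerivAt).fderiv
  exact congrArg (fun T : E →L[ℝ] F => T (L u)) this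

theorem curvature_pullback [FiniteDimensional ℝ E] [FiniteDimensional ℝ F]
    {g : E → E →L[ℝ] E →L[ℝ] ℝ} (hg : IsRiemannianMetric g) (hΓ : ContDiff ℝ ∞ (christoffel g))
    (L : F ≃L[ℂ] E) (x u v w : F) :
    curvature (pullback L g) x u v w = L.symm (curvature g (L x) (L u) (L v) (L w)) := by
  simp only [curvature, fderiv_christoffel_pullback hg hΓ, christoffel_pullback hg,
    ContinuousLinearEquiv.apply_symm_apply, map_add, map_sub]

theorem sectionalCurvature_pullback [FiniteDimensional ℝ E] [FiniteDimensional ℝ F]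
    {g : E → E →L[ℝ] E →L[ℝ] ℝ} (hg : IsRiemannianMetric g) (hΓ : ContDiff ℝ ∞ (christoffel g))
    (L : F ≃L[ℂ] E) (x u v : F) :
    sectionalCurvature (pullback L g) x u v = sectionalCurvature g (L x) (L u) (L v) := by
  simp only [sectionalCurvature, curvature_pullback hg hΓ, pullback_apply,
    ContinuousLinearEquiv.apply_symm_apply]

theorem NegativeSectional.pullback [FiniteDimensional ℝ E] [FiniteDimensional ℝ F]
    {g : E → E →L[ℝ] E →L[ℝ] ℝ} (h : NegativeSectional g) (hg : IsRiemannianMetric g)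
    (hΓ : ContDiff ℝ ∞ (christoffel g)) (L : F ≃L[ℂ] E) : NegativeSectional (pullback L g) := by
  intro x u v huv
  rw [sectionalCurvature_pullback hg hΓ]
  refine h _ _ _ ?_
  rw [LinearIndependent.pair_iff] at huv ⊢
  intro s t hst
  refine huv s t (L.injective ?_)
  rw [map_add, map_zero, ← hst]
  exact congrArg₂ (· + ·) (((L : F →L[ℂ] E).restrictScalars ℝ).map_smul s u)
    (((L : F →L[ℂ] E).restrictScalars ℝ).map_smul t v)

theorem pathLength_pullback (L : F ≃L[ℂ] E) (g : E → E →L[ℝ] E →L[ℝ] ℝ) {γ : ℝ → F}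
    (hγ : ContDiff ℝ 1 γ) : pathLength (pullback L g) γ = pathLength g (L ∘ γ) := by
  have hd : ∀ t, deriv (L ∘ γ) t = L (deriv γ t) := fun t =>
    (((L : F →L[ℂ] E).restrictScalars ℝ).hasFDerivAt.comp_hasDerivAt t
      (hγ.differentiable one_ne_zero t).hasDerivAt).deriv
  simp only [pathLength, pullback_apply, hd, Function.comp_apply]

theorem riemDist_pullback (L : F ≃L[ℂ] E) (g : E → E →L[ℝ] E →L[ℝ] ℝ) (x y : F) :
    riemDist (pullback L g) x y = riemDist g (L x) (L y) := by
  have hL : ContDiff ℝ 1 L := ((L : F →L[ℂ] E).restrictScalars ℝ).contDiff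
  have hL' : ContDiff ℝ 1 L.symm := ((L.symm : E →L[ℂ] F).restrictScalars ℝ).contDiff
  refine le_antisymm ?_ ?_
  · refine le_iInf fun γ => le_iInf fun hγ => le_iInf fun h0 => le_iInf fun h1 => ?_
    refine (riemDist_le_pathLength _ (hL'.comp hγ) (by simp [h0]) (by simp [h1])).trans ?_
    rw [pathLength_pullback L g (hL'.comp hγ)]
    have : L ∘ L.symm ∘ γ = γ := by ext; simp
    rw [this]
  · refine le_iInf fun γ => le_iInf fun hγ => le_iInf fun h0 => le_iInf fun h1 => ?_
    refine (riemDist_le_pathLength _ (hL.comp hγ) (by simp [h0]) (by simp [h1])).trans ?_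
    rw [pathLength_pullback L g hγ]

theorem IsCompleteMetric.pullback {g : E → E →L[ℝ] E →L[ℝ] ℝ} (hg : IsCompleteMetric g)
    (L : F ≃L[ℂ] E) : IsCompleteMetric (pullback L g) := by
  intro s hs
  simp only [riemDist_pullback] at hs
  obtain ⟨x, hx⟩ := hg (fun m => L (s m)) hs
  refine ⟨L.symm x, ?_⟩
  simpa only [riemDist_pullback, ContinuousLinearEquiv.apply_symm_apply] using hx

end Pullback

/-! ### Ricci bounds from curvature bounds by taking traces. -/

section Ricci

/-- Expand the trace in a `B`-orthonormal basis: each diagonal entry is at least `-c`. The space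
carries no prior norm, so `B` can serve as its inner product. -/
theorem neg_mul_finrank_le_trace {V : Type*} [AddCommGroup V] [Module ℝ V] [FiniteDimensional ℝ V]
    {B : V →ₗ[ℝ] V →ₗ[ℝ] ℝ} (hsymm : ∀ u v, B u v = B v u) (hpos : ∀ u, u ≠ 0 → 0 < B u u)
    {T : V →ₗ[ℝ] V} {c : ℝ} (hT : ∀ u, -(c * B u u) ≤ B (T u) u) :
    -(c * Module.finrank ℝ V) ≤ LinearMap.trace ℝ V T := by
  let core : InnerProductSpace.Core ℝ V :=
    { inner u v := B u v
      conj_inner_symm u v := hsymm v u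
      re_inner_nonneg u := by
        rcases eq_or_ne u 0 with rfl | h
        · simp
        · exact (hpos u h).le
      add_left u v w := by simp
      smul_left u v r := by simp
      definite u hu := by
        by_contra h
        exact (hpos u h).ne' hu }
  let : NormedAddCommGroup V := core.toNormedAddCommGroup
  let : InnerProductSpace ℝ V := InnerProductSpace.ofCore core.toCore
  let b := stdOrthonormalBasis ℝ V
  have hin : ∀ u v : V, inner ℝ u v = B u v := fun _ _ => rfl
  have hb : ∀ i, B (b i) (b i) = 1 := fun i => by
    rw [← hin, real_inner_self_eq_norm_sq, b.norm_eq_one, one_pow]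
  rw [LinearMap.trace_eq_sum_inner T b]
  calc -(c * Module.finrank ℝ V) = ∑ _i : Fin (Module.finrank ℝ V), -c := by simp; ring
    _ ≤ _ := Finset.sum_le_sum fun i _ => ?_
  rw [hin, hsymm]
  simpa [hb] using hT (b i)

theorem ricciBoundedBelow_of_le {E : Type*} [NormedAddCommGroup E] [NormedSpace ℝ E]
    [FiniteDimensional ℝ E] {g : E → E →L[ℝ] E →L[ℝ] ℝ} (hg : IsRiemannianMetric g) {c : ℝ}
    (h : ∀ x u v, -(c * (g x u u * g x v v)) ≤ g x (curvature g x u v v) u) :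
    RicciBoundedBelow g := by
  -- The trace gives only a weak inequality; the extra `-1` makes it strict because `g(v,v) > 0`.
  refine ⟨-(c * Module.finrank ℝ E) - 1, fun x v hv => ?_⟩
  have hv' := hg.pos x v hv
  let B : E →ₗ[ℝ] E →ₗ[ℝ] ℝ :=
    { toFun u := (g x u : E →ₗ[ℝ] ℝ)
      map_add' _ _ := by ext; simp
      map_smul' _ _ := by ext; simp }
  have ht := neg_mul_finrank_le_trace (B := B) (fun u w => hg.symm x u w) (fun u => hg.pos x u)
    (T := curvatureEnd g x v v) (c := c * g x v v) fun u => by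
      have := h x u v
      change -(c * g x v v * g x u u) ≤ g x (curvature g x u v v) u
      linarith
  rw [ricci]
  linarith

end Ricci

/-! ### The Ricci bound on the product. -/

section ExpPullback

variable {F : Type*} [NormedAddCommGroup F] [NormedSpace ℂ F] [FiniteDimensional ℝ F] {n : ℕ}

theorem ricciBoundedBelow_pullback_potentialMetric_exp (L : F ≃L[ℂ] Cn n) :
    RicciBoundedBelow (pullback L (potentialMetric n Real.exp)) := by
  have hg := isRiemannianMetric_potentialMetric_exp n
  refine ricciBoundedBelow_of_le (hg.pullback L) (c := 4) fun x u v => ?_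
  rw [curvature_pullback hg (contDiff_christoffel_potentialMetric_exp n)]
  simp only [pullback_apply, ContinuousLinearEquiv.apply_symm_apply]
  refine le_trans ?_ (metric_curvature_potentialMetric_exp_ge (L x) (L u) (L v))
  have h2 : Real.exp (-‖L x‖ ^ 2) ≤ 1 := Real.exp_le_one_iff.2 (by simp)
  have h3 := Real.exp_pos (-‖L x‖ ^ 2)
  have hu : 0 ≤ potentialMetric n Real.exp (L x) (L u) (L u) := by
    rw [potentialMetric_exp_self]
    positivity
  have hv : 0 ≤ potentialMetric n Real.exp (L x) (L v) (L v) := by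
    rw [potentialMetric_exp_self]
    positivity
  have huv := mul_nonneg hu hv
  -- The squared area is at most `g(u,u) g(v,v)`, and `e^{-|z|²} ≤ 1` makes the constant 4 uniform.
  nlinarith [mul_nonneg h3.le (sq_nonneg (potentialMetric n Real.exp (L x) (L u) (L v))),
    mul_nonneg (sub_nonneg.2 h2) huv]

end ExpPullback

end KahlerExample

end

open KahlerExample in
theorem mainTheorem5 :
    (∀ n : ℕ, 1 ≤ n →
      IsKahlerMetric (potentialMetric n Real.exp) ∧
      IsCompleteMetric (potentialMetric n Real.exp) ∧
      NegativeSectional (potentialMetric n Real.exp) ∧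
      SectionalBoundedBelow (potentialMetric n Real.exp) ∧
      ∃ C : ℝ, 0 < C ∧ ∀ z : Cn n, ∃ u v : Cn n, LinearIndependent ℝ ![u, v] ∧
        -(C * Real.exp (-‖z‖ ^ 2)) ≤ sectionalCurvature (potentialMetric n Real.exp) z u v) ∧
    (∀ p q : ℕ, 1 ≤ p → 1 ≤ q → ∀ L : (Cn p × Cn q) ≃L[ℂ] Cn (p + q),
      IsKahlerMetric (pullback L (potentialMetric (p + q) Real.exp)) ∧
      IsCompleteMetric (pullback L (potentialMetric (p + q) Real.exp)) ∧
      NegativeSectional (pullback L (potentialMetric (p + q) Real.exp)) ∧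
      RicciBoundedBelow (pullback L (potentialMetric (p + q) Real.exp))) := by
  refine ⟨fun n hn => ⟨isKahlerMetric_potentialMetric_exp n,
    isCompleteMetric_potentialMetric_exp n, negativeSectional_potentialMetric_exp n,
    sectionalBoundedBelow_potentialMetric_exp n, 4, four_pos, fun z => ?_⟩,
    fun p q _ _ L => ⟨(isKahlerMetric_potentialMetric_exp _).pullback L,
      (isCompleteMetric_potentialMetric_exp _).pullback L,
      (negativeSectional_potentialMetric_exp _).pullback
        (isRiemannianMetric_potentialMetric_exp _) (contDiff_christoffel_potentialMetric_exp _) L,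
      ricciBoundedBelow_pullback_potentialMetric_exp L⟩⟩
  obtain ⟨u, v, h⟩ := exists_linearIndependent_pair hn
  exact ⟨u, v, h, sectionalCurvature_potentialMetric_exp_ge h z⟩
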